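/- Let $N>1$, $d\ge 1$, let $v_1,\dots,v_N\in\mathbb R^d$ span $\mathbb R^d$, and for $i\ne j$ let $a_{ij}:\mathbb R^d\to[0,\infty)$ be continuous. Let $(X,L)$ be the Markov process on $\{1,\dots,N\}\times\mathbb R^d$ in which $X$ jumps from $i$ to $j\neq i$ at rate $a_{ij}(L(t))$ at time $t$, and $L(t)=L(0)+\int_0^t v_{X(s)}\,ds$; its generator is $Af(j,l)=v_j\cdot\nabla_l f(j,l)+\sum_{i\ne j}a_{ji}(l)[f(i,l)-f(j,l)]$. A measure $\pi$ on $\{1,\dots,N\}\times\mathbb R^d$ is invariant if, whenever $(X(0),L(0))$ has law $\pi$, so does $(X(t),L(t))$ for every $t\ge 0$. Let $p_1,\dots,p_N>0$ with $\sum_j p_j=1$, put $b_{ij}(l)=p_ia_{ij}(l)-p_ja_{ji}(l)$, and let $\gamma(l)=(2\pi)^{-d/2}e^{-|l|^2/2}$. For a density $g$, write $p_jg(l)\,dj\,dl$ for the measure giving $\{j\}\times B$ the mass $p_j\int_B g(l)\,dl$. (1) The probability measure $p_j\gamma(l)\,dj\,dl$ is invariant for $(X,L)$ if and only if $$p_jv_j\cdot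 l+\sum_{i\ne j}[p_ia_{ij}(l)-p_ja_{ji}(l)]=0\qquad\text{for all } j=1,\dots,N,\ l\in\mathbb R^d,$$ equivalently, if and only if $$p_jv_j\cdot l+\sum_{i\ne j}b_{ij}(l)=0\qquad\text{for all } j=1,\dots,N,\ l\in\mathbb R^d.\tag{$*$}$$ (2) Conversely, suppose that $(*)$ holds, and let $g\ge 0$ be a differentiable function on $\mathbb R^d$ with $\int_{\mathbb R^d} g(l)\,dl=1$. If $$-p_jv_j\cdot\nabla g(l)+\sum_{i\ne j}[p_ia_{ij}(l)g(l)-p_ja_{ji}(l)g(l)]=0\qquad\text{for all } j=1,\dots,N,\ l\in\mathbb R^d,$$ then $\nabla g(l)=-l\,g(l)$ for all $l$, and $g=\gamma$. Likewise, if $p_jg(l)\,dj\,dl$ is invariant for $(X,L)$, then $g=\gamma$. -/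

import Mathlib

open MeasureTheory

namespace InertDrift

noncomputable section

/-- The state space of the pair (X, L). -/
abbrev State (N d : ℕ) : Type := Fin N × EuclideanSpace ℝ (Fin d)

/-- Total rate at which X leaves the state j while L = l. Here a j i l is the rate of jumps
from j to i while L = l; the diagonal entries a j j are never used. -/
def exitRate {N d : ℕ} (a : Fin N → Fin N → EuclideanSpace ℝ (Fin d) → ℝ)
    (j : Fin N) (l : EuclideanSpace ℝ (Fin d)) : ℝ :=
  ∑ i ∈ Finset.univ.filter (fun i => i ≠ j), a j i l

/-- Probability that the process started at (j, l) has no jump in [0, s]. As long as X stays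
at j, the second component moves along the straight line l + u v_j. -/
def survival {N d : ℕ} (v : Fin N → EuclideanSpace ℝ (Fin d))
    (a : Fin N → Fin N → EuclideanSpace ℝ (Fin d) → ℝ)
    (j : Fin N) (l : EuclideanSpace ℝ (Fin d)) (s : ℝ) : ℝ :=
  Real.exp (-∫ u in (0 : ℝ)..s, exitRate a j (l + u • v j))

/-- Probability that the process started at (j, l) makes exactly n jumps in [0, t] and that
(X(t), L(t)) lies in B, for t ≥ 0: condition on the time s of the first jump and on the state i
entered at that time. -/
def jumpTransition {N d : ℕ} (v : Fin N → EuclideanSpace ℝ (Fin d))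
    (a : Fin N → Fin N → EuclideanSpace ℝ (Fin d) → ℝ) :
    ℕ → ℝ → Fin N → EuclideanSpace ℝ (Fin d) → Set (State N d) → ENNReal
  | 0, t, j, l, B =>
      ENNReal.ofReal (survival v a j l t) * B.indicator (fun _ => 1) (j, l + t • v j)
  | n + 1, t, j, l, B =>
      ∫⁻ s in Set.Icc (0 : ℝ) t, ENNReal.ofReal (survival v a j l s) *
        ∑ i ∈ Finset.univ.filter (fun i => i ≠ j),
          ENNReal.ofReal (a j i (l + s • v j)) *
            jumpTransition v a n (t - s) i (l + s • v j) B

/-- Transition function P((X(t), L(t)) ∈ B | (X(0), L(0)) = x) of the Markov process (X, L) in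
which X jumps from i to j at rate a i j (L(t)) and L(t) = L(0) + ∑ j, v j * (time spent by X at
j up to time t). Since L has bounded speed and the rates are locally bounded, X makes a.s.
finitely many jumps in finite time, so summing over the number of jumps gives everything. -/
def transition {N d : ℕ} (v : Fin N → EuclideanSpace ℝ (Fin d))
    (a : Fin N → Fin N → EuclideanSpace ℝ (Fin d) → ℝ)
    (t : ℝ) (x : State N d) (B : Set (State N d)) : ENNReal :=
  ∑' n : ℕ, jumpTransition v a n t x.1 x.2 B

/-- The measure π is invariant for (X, L): if (X(0), L(0)) has law π, then so has
(X(t), L(t)) for every t ≥ 0. -/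
def IsInvariant {N d : ℕ} (v : Fin N → EuclideanSpace ℝ (Fin d))
    (a : Fin N → Fin N → EuclideanSpace ℝ (Fin d) → ℝ)
    (π : Measure (State N d)) : Prop :=
  ∀ t : ℝ, 0 ≤ t → ∀ B : Set (State N d), MeasurableSet B →
    ∫⁻ x, transition v a t x B ∂π = π B

/-- The product measure p_j g(l) dj dl (counting measure in j, Lebesgue measure in l). -/
def productMeasure {N d : ℕ} (p : Fin N → ℝ) (g : EuclideanSpace ℝ (Fin d) → ℝ) :
    Measure (State N d) :=
  (∑ j : Fin N, ENNReal.ofReal (p j) • Measure.dirac j).prod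
    (volume.withDensity (fun l => ENNReal.ofReal (g l)))

/-- The standard Gaussian density on ℝ^d. -/
def gaussianDensity (d : ℕ) (l : EuclideanSpace ℝ (Fin d)) : ℝ :=
  (2 * Real.pi) ^ (-(d : ℝ) / 2) * Real.exp (-‖l‖ ^ 2 / 2)

/-- b_ij = p_i a_ij - p_j a_ji. -/
def netFlow {N d : ℕ} (p : Fin N → ℝ) (a : Fin N → Fin N → EuclideanSpace ℝ (Fin d) → ℝ)
    (i j : Fin N) (l : EuclideanSpace ℝ (Fin d)) : ℝ :=
  p i * a i j l - p j * a j i l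

/-- The formal adjoint of the generator of (X, L), applied to a function h(j, l). -/
def adjointGenerator {N d : ℕ} (v : Fin N → EuclideanSpace ℝ (Fin d))
    (a : Fin N → Fin N → EuclideanSpace ℝ (Fin d) → ℝ)
    (h : Fin N → EuclideanSpace ℝ (Fin d) → ℝ)
    (j : Fin N) (l : EuclideanSpace ℝ (Fin d)) : ℝ :=
  -inner ℝ (v j) (gradient (h j) l) +
    ∑ i ∈ Finset.univ.filter (fun i => i ≠ j), (a i j l * h i l - a j i l * h j l)

/-- The stationarity equation: the adjoint of the generator annihilates p_j g(l). -/
def StationaryEquation {N d : ℕ} (v : Fin N → EuclideanSpace ℝ (Fin d))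
    (a : Fin N → Fin N → EuclideanSpace ℝ (Fin d) → ℝ)
    (p : Fin N → ℝ) (g : EuclideanSpace ℝ (Fin d) → ℝ) : Prop :=
  ∀ (j : Fin N) (l : EuclideanSpace ℝ (Fin d)),
    adjointGenerator v a (fun i x => p i * g x) j l = 0

end

end InertDrift

namespace InertDrift

noncomputable section

/-! The core is `isInvariant_iff_stationaryEquation`: for differentiable g ≥ 0, invariance of p_j g
is equivalent to the pointwise adjoint equation. It is proved with no theory of generator domains,
by working directly with the series over the number of jumps.

The transition function is a Dyson series: free flights killed at the exit rate, separated by jumps.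
Reversing time shows that, for counting times Lebesgue measure, the adjoint of each term has
velocities -v and transposed rates, with the same killing (`pairing_dyson`). Hence p_j g is
invariant exactly when, at every time t ≥ 0, the adjoint series maps the density ρ = p_j g to itself
almost everywhere (`isInvariant_iff`).

That fixed-point property is compared with Duhamel's formula along lines. If the series fixes ρ,
then ρ equals the Duhamel expression almost everywhere, hence everywhere by continuity, and the
right derivative at t = 0 is the stationarity equation. Conversely, stationarity makes the Duhamel
expression constant in t, so ρ solves the Duhamel equation. Picard iteration then shows that the
series sums to ρ: speeds are bounded, so only rates and densities on a ball matter, and the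
remainder is at most C (M t)^n / n!. In particular no mass is lost to explosion.

The rest is calculus. Since ∇γ = -lγ, the equation for γ is γ times the balance condition. For
general g, the balance condition reduces stationarity to v_j · (∇g + g l) = 0 for all j; as the v_j
span, ∇g = -g l. So g e^{|l|²/2} is constant, and normalization gives g = γ. -/

/-- The probability of no event on `[0, s]` along the line `l + u w` at intensity `q`. -/
def lineSurvival {E : Type*} [NormedAddCommGroup E] [NormedSpace ℝ E]
    (q : E → ℝ) (w l : E) (s : ℝ) : ℝ :=
  Real.exp (-∫ u in (0 : ℝ)..s, q (l + u • w))

/-- Free flight for time `s` with velocities `w`, killed at rate `q`. -/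
def flight {ι E : Type*} [NormedAddCommGroup E] [NormedSpace ℝ E]
    (w : ι → E) (q : ι → E → ℝ) (s : ℝ) (f : ι → E → ENNReal) (j : ι) (l : E) : ENNReal :=
  ENNReal.ofReal (lineSurvival (q j) (w j) l s) * f j (l + s • w j)

/-- The jump operator with rates `r`. -/
def jump {ι E : Type*} [Fintype ι] (r : ι → ι → E → ENNReal) (f : ι → E → ENNReal)
    (j : ι) (l : E) : ENNReal :=
  ∑ i, r j i l * f i l

/-- The terms of the Dyson series of the semigroup with velocities `w`, killing rates `q` and
jump rates `r`: the contribution of the paths with exactly `n` jumps. -/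
def dyson {ι E : Type*} [Fintype ι] [NormedAddCommGroup E] [NormedSpace ℝ E]
    (w : ι → E) (q : ι → E → ℝ) (r : ι → ι → E → ENNReal) :
    ℕ → ℝ → (ι → E → ENNReal) → ι → E → ENNReal
  | 0, t, f => flight w q t f
  | n + 1, t, f => fun j l =>
      ∫⁻ s in Set.Icc (0 : ℝ) t, flight w q s (jump r (dyson w q r n (t - s) f)) j l

/-- The pairing of two families of nonnegative functions. -/
def pairing {ι E : Type*} [Fintype ι] [MeasureSpace E] (h f : ι → E → ENNReal) : ENNReal :=
  ∑ j, ∫⁻ l, h j l * f j l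

/-! ### Measurability, Tonelli on a triangle, and linearity of flights and jumps -/

theorem measurable_setLIntegral_Icc {α : Type*} [MeasurableSpace α] {F : α → ℝ → ENNReal}
    (hF : Measurable fun p : α × ℝ => F p.1 p.2) {τ : α → ℝ} (hτ : Measurable τ) :
    Measurable fun x => ∫⁻ s in Set.Icc (0 : ℝ) (τ x), F x s := by
  have h : ∀ x, ∫⁻ s in Set.Icc (0 : ℝ) (τ x), F x s =
      ∫⁻ s, ({p : α × ℝ | 0 ≤ p.2 ∧ p.2 ≤ τ p.1}.indicator fun p => F p.1 p.2) (x, s) := by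
    intro x
    rw [← lintegral_indicator measurableSet_Icc]
    rfl
  simp_rw [h]
  refine Measurable.lintegral_prod_right' (hF.indicator ?_)
  exact (measurableSet_le measurable_const measurable_snd).inter
    (measurableSet_le measurable_snd (hτ.comp measurable_fst))

/-- Both sides integrate over the triangle s, r ≥ 0, s + r ≤ t, so Tonelli applies to its indicator.
-/
theorem lintegral_triangle_swap {G : ℝ → ℝ → ENNReal}
    (hG : Measurable fun p : ℝ × ℝ => G p.1 p.2) (t : ℝ) :
    ∫⁻ s in Set.Icc (0 : ℝ) t, ∫⁻ r in Set.Icc (0 : ℝ) (t - s), G s r =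
      ∫⁻ r in Set.Icc (0 : ℝ) t, ∫⁻ s in Set.Icc (0 : ℝ) (t - r), G s r := by
  set D : Set (ℝ × ℝ) := {p | 0 ≤ p.1 ∧ 0 ≤ p.2 ∧ p.1 + p.2 ≤ t} with hD
  have hDm : MeasurableSet D :=
    (measurableSet_le measurable_const measurable_fst).inter
      ((measurableSet_le measurable_const measurable_snd).inter
        (measurableSet_le (measurable_fst.add measurable_snd) measurable_const))
  have h1 : ∀ H : ℝ → ℝ → ENNReal,
      ∫⁻ s in Set.Icc (0 : ℝ) t, ∫⁻ r in Set.Icc (0 : ℝ) (t - s), H s r =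
        ∫⁻ s, ∫⁻ r, D.indicator (fun p => H p.1 p.2) (s, r) := by
    intro H
    rw [← lintegral_indicator measurableSet_Icc]
    congr 1 with s
    by_cases hs : s ∈ Set.Icc (0 : ℝ) t
    · rw [Set.indicator_of_mem hs, ← lintegral_indicator measurableSet_Icc]
      congr 1 with r
      by_cases hr : r ∈ Set.Icc (0 : ℝ) (t - s)
      · rw [Set.indicator_of_mem hr, Set.indicator_of_mem]
        exact ⟨hs.1, hr.1, by linarith [hr.2]⟩
      · rw [Set.indicator_of_notMem hr, Set.indicator_of_notMem]
        exact fun h => hr ⟨h.2.1, by linarith [h.2.2]⟩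
    · rw [Set.indicator_of_notMem hs]
      symm
      refine (lintegral_congr fun r => Set.indicator_of_notMem (fun h => hs ?_) _).trans
        lintegral_zero
      exact ⟨h.1, by linarith [h.2.1, h.2.2]⟩
  rw [h1 G, h1 fun r s => G s r, lintegral_lintegral_swap
    (f := fun s r => D.indicator (fun p => G p.1 p.2) (s, r)) (hG.indicator hDm).aemeasurable]
  congr 1 with r
  congr 1 with s
  by_cases h : (s, r) ∈ D
  · rw [Set.indicator_of_mem h, Set.indicator_of_mem]
    exact ⟨h.2.1, h.1, by linarith [h.2.2]⟩
  · rw [Set.indicator_of_notMem h, Set.indicator_of_notMem]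
    exact fun h' => h ⟨h'.2.1, h'.1, by linarith [h'.2.2]⟩

theorem jump_add {ι E : Type*} [Fintype ι] (r : ι → ι → E → ENNReal) (f g : ι → E → ENNReal) (j : ι) (l : E) :
    jump r (fun i x => f i x + g i x) j l = jump r f j l + jump r g j l := by
  simp only [jump, mul_add, Finset.sum_add_distrib]

theorem jump_mono {ι E : Type*} [Fintype ι] (r : ι → ι → E → ENNReal) {f g : ι → E → ENNReal} {l : E}
    (h : ∀ i, f i l ≤ g i l) (j : ι) : jump r f j l ≤ jump r g j l :=
  Finset.sum_le_sum fun i _ => mul_le_mul_right (h i) _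

theorem flight_add {ι E : Type*} [NormedAddCommGroup E] [NormedSpace ℝ E]
    (w : ι → E) (q : ι → E → ℝ) (s : ℝ) (f g : ι → E → ENNReal) (j : ι) (l : E) :
    flight w q s (fun i x => f i x + g i x) j l = flight w q s f j l + flight w q s g j l :=
  mul_add _ _ _

theorem measurable_jump {ι E α : Type*} [Fintype ι] [MeasurableSpace E] [MeasurableSpace α]
    {r : ι → ι → E → ENNReal} (hr : ∀ i j, Measurable (r i j))
    {F : α → ι → E → ENNReal} (hF : ∀ j, Measurable fun p : α × E => F p.1 j p.2)
    (j : ι) :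
    Measurable fun p : α × E => jump r (F p.1) j p.2 :=
  Finset.measurable_sum _ fun i _ => ((hr j i).comp measurable_snd).mul (hF i)

/-- The jump-and-fly operator commutes with integration over a parameter. -/
theorem flight_jump_lintegral {ι E : Type*} [Fintype ι]
    [NormedAddCommGroup E] [NormedSpace ℝ E] [MeasurableSpace E]
    {w : ι → E} {q : ι → E → ℝ} {r : ι → ι → E → ENNReal}  {β : Type*} [MeasurableSpace β]
    (μ : Measure β) (s : ℝ) {G : β → ι → E → ENNReal}
    (hG : ∀ i l, Measurable fun b => G b i l) (j : ι) (l : E) :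
    flight w q s (jump r fun i x => ∫⁻ b, G b i x ∂μ) j l =
      ∫⁻ b, flight w q s (jump r (G b)) j l ∂μ := by
  unfold flight jump
  rw [lintegral_const_mul _ (Finset.measurable_sum _ fun i _ => (hG i _).const_mul _),
    lintegral_finsetSum _ fun i _ => (hG i _).const_mul _]
  congr 1
  exact Finset.sum_congr rfl fun i _ => (lintegral_const_mul _ (hG i _)).symm

/-! ### The terms of the Dyson series and their adjoints -/

section Dyson

variable {ι : Type*} {E : Type} [NormedAddCommGroup E] [NormedSpace ℝ E]

theorem continuous_lineSurvival [FiniteDimensional ℝ E] {q : E → ℝ} (hq : Continuous q) (w : E) :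
    Continuous fun p : E × ℝ => lineSurvival q w p.1 p.2 := by
  have : ProperSpace E := FiniteDimensional.proper ℝ E
  refine Real.continuous_exp.comp (Continuous.neg ?_)
  exact intervalIntegral.continuous_parametric_intervalIntegral_of_continuous
    (f := fun (p : E × ℝ) u => q (p.1 + u • w)) (by fun_prop) continuous_snd

theorem lineSurvival_pos (q : E → ℝ) (w l : E) (s : ℝ) : 0 < lineSurvival q w l s :=
  Real.exp_pos _

theorem lineSurvival_zero (q : E → ℝ) (w l : E) : lineSurvival q w l 0 = 1 := by
  simp [lineSurvival]

theorem lineSurvival_le_one {q : E → ℝ} (hq : ∀ l, 0 ≤ q l) (w l : E) {s : ℝ} (hs : 0 ≤ s) :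
    lineSurvival q w l s ≤ 1 :=
  Real.exp_le_one_iff.2 <| neg_nonpos.2 <|
    intervalIntegral.integral_nonneg hs fun _ _ => hq _

/-- Traversing a segment backwards gives the same survival probability. -/
theorem lineSurvival_reverse (q : E → ℝ) (w l : E) (s : ℝ) :
    lineSurvival q w (l - s • w) s = lineSurvival q (-w) l s := by
  unfold lineSurvival
  congr 2
  have h := intervalIntegral.integral_comp_sub_left (a := 0) (b := s)
    (fun u => q (l + u • -w)) s
  rw [sub_self, sub_zero] at h
  rw [← h]
  congr 1 with u
  congr 1
  rw [sub_smul, smul_neg, smul_neg]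
  abel

variable [MeasurableSpace E] [BorelSpace E] [FiniteDimensional ℝ E]
variable {α : Type*} [MeasurableSpace α]
variable {w : ι → E} {q : ι → E → ℝ} {r : ι → ι → E → ENNReal}

theorem measurable_flight (hq : ∀ j, Continuous (q j))
    {F : α → ι → E → ENNReal} (hF : ∀ j, Measurable fun p : α × E => F p.1 j p.2)
    {τ : α → ℝ} (hτ : Measurable τ) {l : α → E} (hl : Measurable l) (j : ι) :
    Measurable fun x => flight w q (τ x) (F x) j (l x) := by
  have : ProperSpace E := FiniteDimensional.proper ℝ E
  have : SecondCountableTopology E := secondCountable_of_proper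
  refine Measurable.mul ?_ ?_
  · exact ((continuous_lineSurvival (hq j) (w j)).measurable.comp (hl.prodMk hτ)).ennreal_ofReal
  · exact (hF j).comp (measurable_id.prodMk (hl.add (hτ.smul_const (w j))))

variable [Fintype ι]

theorem measurable_dyson (hq : ∀ j, Continuous (q j)) (hr : ∀ i j, Measurable (r i j)) (n : ℕ)
    {α : Type*} [MeasurableSpace α]
    {F : α → ι → E → ENNReal} (hF : ∀ j, Measurable fun p : α × E => F p.1 j p.2)
    {τ : α → ℝ} (hτ : Measurable τ) {l : α → E} (hl : Measurable l) (j : ι) :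
    Measurable fun x => dyson w q r n (τ x) (F x) j (l x) := by
  induction n generalizing α j with
  | zero => exact measurable_flight hq hF hτ hl j
  | succ n ih =>
    refine measurable_setLIntegral_Icc (F := fun x s =>
      flight w q s (jump r (dyson w q r n (τ x - s) (F x))) j (l x)) ?_ hτ
    refine measurable_flight (α := α × ℝ) hq
      (F := fun p => jump r (dyson w q r n (τ p.1 - p.2) (F p.1))) ?_ measurable_snd
      (hl.comp measurable_fst) j
    intro i
    refine measurable_jump (α := α × ℝ) hr
      (F := fun p => dyson w q r n (τ p.1 - p.2) (F p.1)) ?_ i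
    intro k
    refine ih (α := (α × ℝ) × E) (F := fun p => F p.1.1) ?_ (by fun_prop) (by fun_prop) k
    intro m
    exact (hF m).comp (by fun_prop : Measurable fun p : ((α × ℝ) × E) × E => (p.1.1.1, p.2))

/-- The Dyson recursion, decomposed at the last jump instead of the first. -/
theorem dyson_succ_last (hq : ∀ j, Continuous (q j)) (hr : ∀ i j, Measurable (r i j)) (n : ℕ)
    {f : ι → E → ENNReal} (hf : ∀ j, Measurable (f j)) (t : ℝ) (j : ι) (l : E) :
    dyson w q r (n + 1) t f j l =
      ∫⁻ s in Set.Icc (0 : ℝ) t, dyson w q r n (t - s) (jump r (flight w q s f)) j l := by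
  have hJ : ∀ i, Measurable fun p : ℝ × E => jump r (flight w q p.1 f) i p.2 := fun i =>
    measurable_jump (α := ℝ) hr (F := fun s => flight w q s f) (fun k =>
      measurable_flight (α := ℝ × E) hq (F := fun _ => f) (fun m => (hf m).comp measurable_snd)
        measurable_fst measurable_snd k) i
  induction n generalizing t j l with
  | zero =>
    -- With one jump, the substitution s ↦ t - s exchanges the flight times before and after it.
    have h := lintegral_sub_left_eq_self (μ := volume)
      ((Set.Icc (0 : ℝ) t).indicator fun s => flight w q s (jump r (flight w q (t - s) f)) j l) t
    simp only [dyson]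
    rw [← lintegral_indicator measurableSet_Icc, ← lintegral_indicator measurableSet_Icc, ← h]
    congr 1 with s
    by_cases hs : s ∈ Set.Icc (0 : ℝ) t
    · rw [Set.indicator_of_mem hs, Set.indicator_of_mem, sub_sub_cancel]
      exact ⟨by linarith [hs.2], by linarith [hs.1]⟩
    · rw [Set.indicator_of_notMem hs, Set.indicator_of_notMem]
      exact fun h' => hs ⟨by linarith [h'.2], by linarith [h'.1]⟩
  | succ n ih =>
    have hG : ∀ i, Measurable fun p : (ℝ × ℝ) × E =>
        dyson w q r n (t - p.1.1 - p.1.2) (jump r (flight w q p.1.2 f)) i p.2 := fun i =>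
      measurable_dyson hq hr n (α := (ℝ × ℝ) × E)
        (F := fun p => jump r (flight w q p.1.2 f))
        (fun k => (hJ k).comp (by fun_prop :
          Measurable fun p : ((ℝ × ℝ) × E) × E => (p.1.1.2, p.2))) (by fun_prop) (by fun_prop) i
    -- Here s is the time of the first jump and x the length of the flight after the last one; the
    -- two integrations are exchanged on the triangle.
    calc dyson w q r (n + 1 + 1) t f j l
        = ∫⁻ s in Set.Icc (0 : ℝ) t, ∫⁻ x in Set.Icc (0 : ℝ) (t - s),
            flight w q s (jump r (dyson w q r n (t - s - x) (jump r (flight w q x f)))) j l := by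
          rw [dyson]
          refine lintegral_congr fun s => ?_
          have h : dyson w q r (n + 1) (t - s) f = fun i y => ∫⁻ x in Set.Icc (0 : ℝ) (t - s),
              dyson w q r n (t - s - x) (jump r (flight w q x f)) i y := by
            funext i y
            exact ih _ _ _
          rw [h, flight_jump_lintegral]
          · exact fun i y => (hG i).comp (by fun_prop : Measurable fun b : ℝ => ((s, b), y))
      _ = ∫⁻ x in Set.Icc (0 : ℝ) t, ∫⁻ s in Set.Icc (0 : ℝ) (t - x),
            flight w q s (jump r (dyson w q r n (t - s - x) (jump r (flight w q x f)))) j l := by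
          refine lintegral_triangle_swap (G := fun s x =>
            flight w q s (jump r (dyson w q r n (t - s - x) (jump r (flight w q x f)))) j l) ?_ t
          refine measurable_flight (α := ℝ × ℝ) hq (F := fun p =>
            jump r (dyson w q r n (t - p.1 - p.2) (jump r (flight w q p.2 f)))) ?_
            measurable_fst measurable_const j
          exact measurable_jump (α := ℝ × ℝ) hr (F := fun p =>
            dyson w q r n (t - p.1 - p.2) (jump r (flight w q p.2 f))) hG
      _ = _ := by
          congr 1 with x
          rw [dyson]
          congr 1 with s
          rw [sub_right_comm]

theorem lintegral_pairing {E β : Type*} [MeasureSpace E] [SFinite (volume : Measure E)]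
    [MeasurableSpace β] (μ : Measure β) [SFinite μ]
    {h : ι → E → ENNReal} (hh : ∀ j, Measurable (h j)) {G : β → ι → E → ENNReal}
    (hG : ∀ j, Measurable fun p : β × E => G p.1 j p.2) :
    pairing h (fun j l => ∫⁻ b, G b j l ∂μ) = ∫⁻ b, pairing h (G b) ∂μ := by
  unfold pairing
  have hm : ∀ j, Measurable fun p : β × E => h j p.2 * G p.1 j p.2 := fun j =>
    ((hh j).comp measurable_snd).mul (hG j)
  rw [lintegral_finsetSum _ fun j _ => (hm j).lintegral_prod_right']
  refine Finset.sum_congr rfl fun j _ => ?_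
  rw [lintegral_lintegral_swap (f := fun b l => h j l * G b j l) (hm j).aemeasurable]
  congr 1 with l
  rw [lintegral_const_mul]
  exact (hG j).comp (measurable_id.prodMk measurable_const)

theorem pairing_comm {E : Type*} [MeasureSpace E] (h f : ι → E → ENNReal) :
    pairing h f = pairing f h := by
  simp only [pairing, mul_comm]

theorem pairing_jump {E : Type*} [MeasureSpace E] {r : ι → ι → E → ENNReal}
    (hr : ∀ i j, Measurable (r i j)) {h f : ι → E → ENNReal} (hh : ∀ j, Measurable (h j))
    (hf : ∀ j, Measurable (f j)) :
    pairing h (jump r f) = pairing (jump (fun j i => r i j) h) f := by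
  unfold pairing jump
  simp only [Finset.mul_sum, Finset.sum_mul]
  have h1 : ∀ j i, Measurable fun l => h j l * (r j i l * f i l) := fun j i =>
    (hh j).mul ((hr j i).mul (hf i))
  have h2 : ∀ j i, Measurable fun l => r i j l * h i l * f j l := fun j i =>
    ((hr i j).mul (hh i)).mul (hf j)
  simp_rw [lintegral_finsetSum _ fun i _ => h1 _ i, lintegral_finsetSum _ fun i _ => h2 _ i]
  rw [Finset.sum_comm]
  refine Finset.sum_congr rfl fun j _ => Finset.sum_congr rfl fun i _ => lintegral_congr fun l => ?_
  ring

/-- Translate l by -s w_j, which preserves the measure; the survival factor becomes that of the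
reversed segment. -/
theorem pairing_flight {E : Type} [NormedAddCommGroup E] [NormedSpace ℝ E] [MeasureSpace E]
    [BorelSpace E] [(volume : Measure E).IsAddRightInvariant]
    (w : ι → E) (q : ι → E → ℝ) (s : ℝ) (h f : ι → E → ENNReal) :
    pairing h (flight w q s f) = pairing (flight (fun j => -w j) q s h) f := by
  unfold pairing flight
  refine Finset.sum_congr rfl fun j _ => ?_
  rw [← lintegral_sub_right_eq_self _ (s • w j)]
  congr 1 with l
  simp only [lineSurvival_reverse, sub_add_cancel, smul_neg, ← sub_eq_add_neg]
  ring

/-- The adjoint of a term of the Dyson series has reversed velocities and transposed rates. -/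
theorem pairing_dyson {E : Type} [NormedAddCommGroup E] [NormedSpace ℝ E] [MeasureSpace E]
    [BorelSpace E] [FiniteDimensional ℝ E] [SFinite (volume : Measure E)]
    [(volume : Measure E).IsAddRightInvariant]
    {w : ι → E} {q : ι → E → ℝ} {r : ι → ι → E → ENNReal}
    (hq : ∀ j, Continuous (q j)) (hr : ∀ i j, Measurable (r i j)) (n : ℕ) (t : ℝ)
    {h f : ι → E → ENNReal} (hh : ∀ j, Measurable (h j)) (hf : ∀ j, Measurable (f j)) :
    pairing h (dyson w q r n t f) =
      pairing (dyson (fun j => -w j) q (fun j i => r i j) n t h) f := by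
  induction n generalizing t h f with
  | zero => exact pairing_flight w q t h f
  | succ n ih =>
    have hr' : ∀ i j, Measurable (r j i) := fun i j => hr j i
    have hD : ∀ j, Measurable fun p : ℝ × E => dyson w q r n (t - p.1) f j p.2 := fun j =>
      measurable_dyson (α := ℝ × E) hq hr n (F := fun _ => f)
        (fun i => (hf i).comp measurable_snd) (by fun_prop) (by fun_prop) j
    have hJ : ∀ j, Measurable fun p : ℝ × E => jump r (dyson w q r n (t - p.1) f) j p.2 :=
      measurable_jump (α := ℝ) hr (F := fun s => dyson w q r n (t - s) f) hD
    have hF : ∀ j, Measurable fun p : ℝ × E =>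
        flight w q p.1 (jump r (dyson w q r n (t - p.1) f)) j p.2 := fun j =>
      measurable_flight (α := ℝ × E) hq
        (F := fun p => jump r (dyson w q r n (t - p.1) f))
        (fun i => (hJ i).comp (by fun_prop : Measurable fun p : (ℝ × E) × E => (p.1.1, p.2)))
        measurable_fst measurable_snd j
    have hS : ∀ j, Measurable fun p : ℝ × E => flight (fun j => -w j) q p.1 h j p.2 := fun j =>
      measurable_flight (α := ℝ × E) hq (F := fun _ => h)
        (fun i => (hh i).comp measurable_snd) measurable_fst measurable_snd j
    have hK : ∀ j, Measurable fun p : ℝ × E =>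
        jump (fun j i => r i j) (flight (fun j => -w j) q p.1 h) j p.2 :=
      measurable_jump (α := ℝ) hr' (F := fun s => flight (fun j => -w j) q s h) hS
    have hL : ∀ j, Measurable fun p : ℝ × E => dyson (fun j => -w j) q (fun j i => r i j) n
        (t - p.1) (jump (fun j i => r i j) (flight (fun j => -w j) q p.1 h)) j p.2 := fun j =>
      measurable_dyson (α := ℝ × E) hq hr' n
        (F := fun p => jump (fun j i => r i j) (flight (fun j => -w j) q p.1 h))
        (fun i => (hK i).comp (by fun_prop : Measurable fun p : (ℝ × E) × E => (p.1.1, p.2)))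
        (by fun_prop) measurable_snd j
    have hcut : ∀ {G : ι → ℝ × E → ENNReal}, (∀ j, Measurable (G j)) → ∀ s j,
        Measurable fun l => G j (s, l) := fun hG s j => (hG j).comp measurable_prodMk_left
    have h1 := lintegral_pairing (volume.restrict (Set.Icc 0 t)) hh
      (G := fun s => flight w q s (jump r (dyson w q r n (t - s) f))) hF
    have h2 := lintegral_pairing (volume.restrict (Set.Icc 0 t)) hf
      (G := fun s => dyson (fun j => -w j) q (fun j i => r i j) n
        (t - s) (jump (fun j i => r i j) (flight (fun j => -w j) q s h))) hL
    -- Passing to the adjoint turns the first jump into the last, so the reversed series has to be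
    -- expanded at its last jump.
    have h3 : dyson (fun j => -w j) q (fun j i => r i j) (n + 1) t h = fun j l =>
        ∫⁻ s in Set.Icc (0 : ℝ) t, dyson (fun j => -w j) q (fun j i => r i j) n
          (t - s) (jump (fun j i => r i j) (flight (fun j => -w j) q s h)) j l := by
      funext j l
      exact dyson_succ_last hq hr' n hh t j l
    rw [h3, pairing_comm _ f]
    refine h1.trans (Eq.trans ?_ h2.symm)
    congr 1 with s
    have hKs : ∀ j, Measurable (jump (fun j i => r i j) (flight (fun j => -w j) q s h) j) :=
      hcut hK s
    rw [pairing_flight, pairing_jump hr (h := flight (fun j => -w j) q s h)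
      (f := dyson w q r n (t - s) f) (hcut hS s) (hcut hD s), ih _ hKs hf, pairing_comm f]

end Dyson

/-! ### Duhamel's formula and convergence by Picard iteration -/

section Series

variable {ι : Type*} {E : Type} [Fintype ι] [NormedAddCommGroup E] [NormedSpace ℝ E]
  [MeasurableSpace E] [BorelSpace E] [FiniteDimensional ℝ E]
variable {w : ι → E} {q : ι → E → ℝ} {r : ι → ι → E → ENNReal}

theorem measurable_flight_jump_dyson (hq : ∀ j, Continuous (q j))
    (hr : ∀ i j, Measurable (r i j)) (n : ℕ) {f : ι → E → ENNReal} (hf : ∀ j, Measurable (f j))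
    (t : ℝ) (j : ι) :
    Measurable fun p : ℝ × E => flight w q p.1 (jump r (dyson w q r n (t - p.1) f)) j p.2 := by
  have hD : ∀ j, Measurable fun p : ℝ × E => dyson w q r n (t - p.1) f j p.2 := fun j =>
    measurable_dyson (α := ℝ × E) hq hr n (F := fun _ => f)
      (fun i => (hf i).comp measurable_snd) (by fun_prop) (by fun_prop) j
  have hJ : ∀ j, Measurable fun p : ℝ × E => jump r (dyson w q r n (t - p.1) f) j p.2 :=
    measurable_jump (α := ℝ) hr (F := fun s => dyson w q r n (t - s) f) hD
  exact measurable_flight (α := ℝ × E) hq (F := fun p => jump r (dyson w q r n (t - p.1) f))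
    (fun i => (hJ i).comp (by fun_prop : Measurable fun p : (ℝ × E) × E => (p.1.1, p.2)))
    measurable_fst measurable_snd j

theorem measurable_flight_jump_dyson_left (hq : ∀ j, Continuous (q j))
    (hr : ∀ i j, Measurable (r i j)) (n : ℕ) {f : ι → E → ENNReal} (hf : ∀ j, Measurable (f j))
    (t : ℝ) (j : ι) (l : E) :
    Measurable fun s => flight w q s (jump r (dyson w q r n (t - s) f)) j l := by
  have h : Measurable fun s : ℝ => (s, l) := measurable_prodMk_right
  have h2 := (measurable_flight_jump_dyson (w := w) hq hr n hf t j).comp h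
  exact h2

theorem flight_jump_tsum {ι E : Type*} [Fintype ι] [NormedAddCommGroup E] [NormedSpace ℝ E]
    (w : ι → E) (q : ι → E → ℝ) (r : ι → ι → E → ENNReal) (s : ℝ)
    (G : ℕ → ι → E → ENNReal) (j : ι) (l : E) :
    flight w q s (jump r fun i x => ∑' k, G k i x) j l =
      ∑' k, flight w q s (jump r (G k)) j l := by
  unfold flight jump
  rw [ENNReal.tsum_mul_left, Summable.tsum_finsetSum fun _ _ => ENNReal.summable]
  simp only [ENNReal.tsum_mul_left]

theorem flight_jump_sum {ι E : Type*} [Fintype ι] [NormedAddCommGroup E] [NormedSpace ℝ E]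
    (w : ι → E) (q : ι → E → ℝ) (r : ι → ι → E → ENNReal) (s : ℝ) (n : ℕ)
    (G : ℕ → ι → E → ENNReal) (j : ι) (l : E) :
    flight w q s (jump r fun i x => ∑ k ∈ Finset.range n, G k i x) j l =
      ∑ k ∈ Finset.range n, flight w q s (jump r (G k)) j l := by
  unfold flight jump
  simp only [Finset.mul_sum]
  exact Finset.sum_comm

theorem flight_mono {ι E : Type*} [NormedAddCommGroup E] [NormedSpace ℝ E]
    (w : ι → E) (q : ι → E → ℝ) (s : ℝ) {f g : ι → E → ENNReal} {j : ι} {l : E}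
    (h : f j (l + s • w j) ≤ g j (l + s • w j)) : flight w q s f j l ≤ flight w q s g j l :=
  mul_le_mul_right h _

/-- Duhamel's formula for the Dyson series. -/
theorem tsum_dyson (hq : ∀ j, Continuous (q j))
    (hr : ∀ i j, Measurable (r i j)) {f : ι → E → ENNReal} (hf : ∀ j, Measurable (f j))
    (t : ℝ) (j : ι) (l : E) :
    ∑' n, dyson w q r n t f j l = flight w q t f j l +
      ∫⁻ s in Set.Icc (0 : ℝ) t,
        flight w q s (jump r fun i x => ∑' n, dyson w q r n (t - s) f i x) j l := by
  rw [tsum_eq_zero_add' ENNReal.summable]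
  simp_rw [flight_jump_tsum]
  rw [lintegral_tsum fun n => 
    (measurable_flight_jump_dyson_left hq hr n hf t j l).aemeasurable]
  rfl

theorem sum_range_succ_dyson (hq : ∀ j, Continuous (q j))
    (hr : ∀ i j, Measurable (r i j)) {f : ι → E → ENNReal} (hf : ∀ j, Measurable (f j))
    (n : ℕ) (t : ℝ) (j : ι) (l : E) :
    ∑ k ∈ Finset.range (n + 1), dyson w q r k t f j l = flight w q t f j l +
      ∫⁻ s in Set.Icc (0 : ℝ) t, flight w q s
        (jump r fun i x => ∑ k ∈ Finset.range n, dyson w q r k (t - s) f i x) j l := by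
  rw [Finset.sum_range_succ', add_comm]
  simp_rw [flight_jump_sum]
  rw [lintegral_finsetSum _ fun k _ => measurable_flight_jump_dyson_left hq hr k hf t j l]
  rfl

/-- The partial sums are the Picard iterates started from 0 ≤ f, and the Duhamel map is monotone
with fixed point f. -/
theorem sum_dyson_le (hq : ∀ j, Continuous (q j))
    (hr : ∀ i j, Measurable (r i j)) {f : ι → E → ENNReal} (hf : ∀ j, Measurable (f j))
    (hfix : ∀ t, 0 ≤ t → ∀ j l, f j l = flight w q t f j l +
      ∫⁻ s in Set.Icc (0 : ℝ) t, flight w q s (jump r f) j l)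
    (n : ℕ) {t : ℝ} (ht : 0 ≤ t) (j : ι) (l : E) :
    ∑ k ∈ Finset.range n, dyson w q r k t f j l ≤ f j l := by
  induction n generalizing t j l with
  | zero => simp
  | succ n ih =>
    rw [sum_range_succ_dyson hq hr hf, hfix t ht j l]
    refine add_le_add le_rfl ?_
    refine setLIntegral_mono' measurableSet_Icc fun s hs => flight_mono w q s ?_
    exact jump_mono r (fun i => ih (sub_nonneg.2 hs.2) i _) j

/-- One step of the remainder recursion in `le_sum_dyson_add`. -/
theorem lintegral_pow_div_factorial {C M t : ℝ} (hC : 0 ≤ C) (hM : 0 ≤ M) (ht : 0 ≤ t) (n : ℕ) :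
    ∫⁻ s in Set.Icc (0 : ℝ) t, ENNReal.ofReal (M * (C * (M * (t - s)) ^ n / n.factorial)) =
      ENNReal.ofReal (C * (M * t) ^ (n + 1) / (n + 1).factorial) := by
  have hc : Continuous fun s : ℝ => M * (C * (M * (t - s)) ^ n / n.factorial) := by fun_prop
  rw [← ofReal_integral_eq_lintegral_ofReal
    (hc.integrableOn_Icc) (ae_restrict_of_forall_mem measurableSet_Icc fun s hs => ?_)]
  · congr 1
    rw [integral_Icc_eq_integral_Ioc, ← intervalIntegral.integral_of_le ht]
    have h := intervalIntegral.integral_comp_sub_left (a := 0) (b := t)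
      (fun s => M * (C * (M * s) ^ n / n.factorial)) t
    rw [h]
    simp only [mul_pow, sub_self, sub_zero]
    have h2 : ∀ s : ℝ, M * (C * (M ^ n * s ^ n) / n.factorial) =
        (M ^ (n + 1) * C / n.factorial) * s ^ n := fun s => by ring
    simp_rw [h2]
    rw [intervalIntegral.integral_const_mul, integral_pow, Nat.factorial_succ]
    push_cast
    field_simp
    simp
  · have : 0 ≤ t - s := sub_nonneg.2 hs.2
    positivity

/-- At speed at most V, a path from l stays in the ball of radius R up to time t, so the bounds C on
f and M on the total jump rate suffice there. Each iteration integrates M times the previous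
remainder, since survival probabilities are at most 1. -/
theorem le_sum_dyson_add (hq : ∀ j, Continuous (q j)) (hq0 : ∀ j l, 0 ≤ q j l)
    (hr : ∀ i j, Measurable (r i j)) {f : ι → E → ENNReal} (hf : ∀ j, Measurable (f j))
    (hfix : ∀ t, 0 ≤ t → ∀ j l, f j l = flight w q t f j l +
      ∫⁻ s in Set.Icc (0 : ℝ) t, flight w q s (jump r f) j l)
    {C M R V : ℝ} (hC : 0 ≤ C) (hM : 0 ≤ M) (hV : ∀ j, ‖w j‖ ≤ V)
    (hfC : ∀ j l, ‖l‖ ≤ R → f j l ≤ ENNReal.ofReal C)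
    (hrM : ∀ j l, ‖l‖ ≤ R → ∑ i, r j i l ≤ ENNReal.ofReal M)
    (n : ℕ) {t : ℝ} (ht : 0 ≤ t) (j : ι) (l : E) (hl : ‖l‖ + t * V ≤ R) :
    f j l ≤ ∑ k ∈ Finset.range n, dyson w q r k t f j l +
      ENNReal.ofReal (C * (M * t) ^ n / n.factorial) := by
  have hV0 : 0 ≤ V := (norm_nonneg _).trans (hV j)
  induction n generalizing t j l with
  | zero =>
    have : ‖l‖ ≤ R := by nlinarith
    simpa using hfC j l this
  | succ n ih =>
    rw [sum_range_succ_dyson hq hr hf, hfix t ht j l, add_assoc]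
    refine add_le_add le_rfl ?_
    rw [← lintegral_pow_div_factorial hC hM ht n, ← lintegral_add_right _ (by fun_prop)]
    refine setLIntegral_mono' measurableSet_Icc fun s hs => ?_
    set x := l + s • w j with hx
    have hxn : ‖x‖ ≤ ‖l‖ + s * V := (norm_add_le _ _).trans <| by
      rw [norm_smul, Real.norm_of_nonneg hs.1]
      gcongr
      · exact hs.1
      · exact hV j
    have hts : 0 ≤ t - s := sub_nonneg.2 hs.2
    have hxR : ‖x‖ + (t - s) * V ≤ R := by linarith
    have hxR' : ‖x‖ ≤ R := by nlinarith
    have hsurv : ENNReal.ofReal (lineSurvival (q j) (w j) l s) ≤ 1 :=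
      ENNReal.ofReal_le_one.2 (lineSurvival_le_one (hq0 j) _ _ hs.1)
    calc flight w q s (jump r f) j l
        ≤ flight w q s (fun i y => jump r (fun i x =>
            ∑ k ∈ Finset.range n, dyson w q r k (t - s) f i x) i y + jump r (fun _ _ =>
              ENNReal.ofReal (C * (M * (t - s)) ^ n / n.factorial)) i y) j l := by
          refine flight_mono w q s ?_
          rw [← jump_add]
          exact jump_mono r (fun i => ih hts i x hxR) j
      _ ≤ _ := by
          rw [flight_add]
          refine add_le_add le_rfl ?_
          unfold flight jump
          rw [← Finset.sum_mul, ENNReal.ofReal_mul hM]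
          calc _ ≤ 1 * _ := mul_le_mul_left hsurv _
            _ ≤ _ := by
              rw [one_mul]
              exact mul_le_mul_left (hrM j x hxR') _

/-- A locally bounded solution of the Duhamel equation is a fixed point of the Dyson series:
there is no loss of mass through infinitely many jumps. -/
theorem tsum_dyson_eq_self (hq : ∀ j, Continuous (q j)) (hq0 : ∀ j l, 0 ≤ q j l)
    (hr : ∀ i j, Measurable (r i j)) {f : ι → E → ENNReal} (hf : ∀ j, Measurable (f j))
    (hfix : ∀ t, 0 ≤ t → ∀ j l, f j l = flight w q t f j l +
      ∫⁻ s in Set.Icc (0 : ℝ) t, flight w q s (jump r f) j l)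
    (hfC : ∀ R, ∃ C, 0 ≤ C ∧ ∀ j l, ‖l‖ ≤ R → f j l ≤ ENNReal.ofReal C)
    (hrM : ∀ R, ∃ M, 0 ≤ M ∧ ∀ j l, ‖l‖ ≤ R → ∑ i, r j i l ≤ ENNReal.ofReal M)
    {t : ℝ} (ht : 0 ≤ t) (j : ι) (l : E) :
    ∑' n, dyson w q r n t f j l = f j l := by
  refine le_antisymm ?_ ?_
  · exact ENNReal.summable.tsum_le_of_sum_range_le fun n => sum_dyson_le hq hr hf hfix n ht j l
  -- A crude speed bound valid for all velocities; it fixes the ball on which C and M are chosen,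
  -- independently of n.
  · set V := ∑ i, ‖w i‖ with hV
    obtain ⟨C, hC, hfC⟩ := hfC (‖l‖ + t * V)
    obtain ⟨M, hM, hrM⟩ := hrM (‖l‖ + t * V)
    have h1 : ∀ n : ℕ, f j l ≤ ∑' k, dyson w q r k t f j l +
        ENNReal.ofReal (C * ((M * t) ^ n / n.factorial)) := fun n => by
      rw [← mul_div_assoc]
      refine (le_sum_dyson_add hq hq0 hr hf hfix hC hM (fun i => ?_) hfC hrM n ht j l le_rfl).trans
        (add_le_add_left (ENNReal.sum_le_tsum _) _)
      exact Finset.single_le_sum (f := fun i => ‖w i‖) (fun _ _ => norm_nonneg _)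
        (Finset.mem_univ i)
    have h2 := ENNReal.tendsto_ofReal
      ((FloorSemiring.tendsto_pow_div_factorial_atTop (M * t)).const_mul C)
    rw [mul_zero, ENNReal.ofReal_zero] at h2
    have h3 := (tendsto_const_nhds (x := ∑' k, dyson w q r k t f j l)).add h2
    rw [add_zero] at h3
    exact ge_of_tendsto' h3 h1

end Series

/-! ### The Duhamel expression as a function of time -/

section Duhamel

variable {E : Type} [NormedAddCommGroup E] [NormedSpace ℝ E]

theorem hasDerivAt_lineSurvival {q : E → ℝ} (hq : Continuous q) (w l : E) (t : ℝ) :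
    HasDerivAt (lineSurvival q w l) (-(q (l + t • w)) * lineSurvival q w l t) t := by
  have hc : Continuous fun u : ℝ => q (l + u • w) := by fun_prop
  have h := (hc.integral_hasStrictDerivAt 0 t).hasDerivAt.neg.exp
  rw [mul_comm] at h
  exact h

/-- The right-hand side of Duhamel's formula along a line, for the initial value `ρ` and the
source `φ`. -/
def duhamel (q : E → ℝ) (w : E) (ρ φ : E → ℝ) (l : E) (t : ℝ) : ℝ :=
  lineSurvival q w l t * ρ (l + t • w) +
    ∫ s in (0 : ℝ)..t, lineSurvival q w l s * φ (l + s • w)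

theorem duhamel_nonneg {q ρ φ : E → ℝ} (hρ : ∀ l, 0 ≤ ρ l) (hφ : ∀ l, 0 ≤ φ l) (w l : E) {t : ℝ}
    (ht : 0 ≤ t) : 0 ≤ duhamel q w ρ φ l t :=
  add_nonneg (mul_nonneg (lineSurvival_pos _ _ _ _).le (hρ _))
    (intervalIntegral.integral_nonneg ht fun _ _ =>
      mul_nonneg (lineSurvival_pos _ _ _ _).le (hφ _))

theorem duhamel_zero (q : E → ℝ) (w : E) (ρ φ : E → ℝ) (l : E) : duhamel q w ρ φ l 0 = ρ l := by
  simp [duhamel, lineSurvival_zero]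

theorem continuous_lineSurvival_right {q : E → ℝ} (hq : Continuous q) (w l : E) :
    Continuous (lineSurvival q w l) :=
  continuous_iff_continuousAt.2 fun t => (hasDerivAt_lineSurvival hq w l t).continuousAt

/-- Every term carries the survival factor. When φ is the gain from jumps, the remaining bracket is
the left side of the stationarity equation. -/
theorem hasDerivAt_duhamel {q ρ φ : E → ℝ} (hq : Continuous q) (hρ : Differentiable ℝ ρ)
    (hφ : Continuous φ) (w l : E) (t : ℝ) :
    HasDerivAt (duhamel q w ρ φ l)
      (lineSurvival q w l t * (fderiv ℝ ρ (l + t • w) w - q (l + t • w) * ρ (l + t • w) +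
        φ (l + t • w))) t := by
  have hline : HasDerivAt (fun s : ℝ => l + s • w) w t := by
    simpa using ((hasDerivAt_id t).smul_const w).const_add l
  have h1 := (hρ (l + t • w)).hasFDerivAt.comp_hasDerivAt t hline
  have hc : Continuous fun s : ℝ => lineSurvival q w l s * φ (l + s • w) :=
    (continuous_lineSurvival_right hq w l).mul (by fun_prop)
  have h2 := (hc.integral_hasStrictDerivAt 0 t).hasDerivAt
  refine (((hasDerivAt_lineSurvival hq w l t).mul h1).add h2).congr_deriv ?_
  simp only [Function.comp_apply]
  ring

theorem continuous_duhamel [FiniteDimensional ℝ E] {q ρ φ : E → ℝ} (hq : Continuous q)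
    (hρ : Continuous ρ) (hφ : Continuous φ) (w : E) (t : ℝ) :
    Continuous fun l => duhamel q w ρ φ l t := by
  have hs := continuous_lineSurvival hq w
  refine Continuous.add (Continuous.mul (hs.comp (by fun_prop :
    Continuous fun l : E => (l, t))) (by fun_prop)) ?_
  exact intervalIntegral.continuous_parametric_intervalIntegral_of_continuous'
    (f := fun (l : E) s => lineSurvival q w l s * φ (l + s • w))
    (hs.mul (by fun_prop)) 0 t

end Duhamel

/-! ### Stationary densities versus fixed points of the series -/

section Stationary

variable {ι : Type*} {E : Type} [Fintype ι] [NormedAddCommGroup E] [NormedSpace ℝ E]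
variable {w : ι → E} {q : ι → E → ℝ} {c : ι → ι → E → ℝ} {ρ : ι → E → ℝ}

/-- The real-valued rates `c` as extended nonnegative rates. -/
def extRate {ι E : Type*} (c : ι → ι → E → ℝ) (j i : ι) (l : E) : ENNReal :=
  ENNReal.ofReal (c j i l)

/-- The real-valued functions `ρ` as extended nonnegative functions. -/
def extDensity {ι E : Type*} (ρ : ι → E → ℝ) (j : ι) (l : E) : ENNReal :=
  ENNReal.ofReal (ρ j l)

theorem jump_extDensity {ι E : Type*} [Fintype ι] {c : ι → ι → E → ℝ} {ρ : ι → E → ℝ}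
    (hc : ∀ j i l, 0 ≤ c j i l) (hρ : ∀ j l, 0 ≤ ρ j l) (j : ι) (l : E) :
    jump (extRate c) (extDensity ρ) j l = ENNReal.ofReal (∑ i, c j i l * ρ i l) := by
  unfold jump extRate extDensity
  rw [ENNReal.ofReal_sum_of_nonneg fun i _ => mul_nonneg (hc j i l) (hρ i l)]
  exact Finset.sum_congr rfl fun i _ => (ENNReal.ofReal_mul (hc j i l)).symm

/-- Links the extended nonnegative integrals of the series to a real expression that can be
differentiated. -/
theorem duhamel_eq_ofReal (hq : ∀ j, Continuous (q j)) (hc0 : ∀ j i l, 0 ≤ c j i l)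
    (hc : ∀ j i, Continuous (c j i)) (hρ0 : ∀ j l, 0 ≤ ρ j l) (hρ : ∀ j, Continuous (ρ j))
    {t : ℝ} (ht : 0 ≤ t) (j : ι) (l : E) :
    flight w q t (extDensity ρ) j l +
        ∫⁻ s in Set.Icc (0 : ℝ) t, flight w q s (jump (extRate c) (extDensity ρ)) j l =
      ENNReal.ofReal (duhamel (q j) (w j) (ρ j) (fun x => ∑ i, c j i x * ρ i x) l t) := by
  set φ : E → ℝ := fun x => ∑ i, c j i x * ρ i x with hφ
  have hφ0 : ∀ x, 0 ≤ φ x := fun x =>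
    Finset.sum_nonneg fun i _ => mul_nonneg (hc0 j i x) (hρ0 i x)
  have hφc : Continuous φ := continuous_finsetSum _ fun i _ => (hc j i).mul (hρ i)
  have hcont : Continuous fun s : ℝ => lineSurvival (q j) (w j) l s * φ (l + s • w j) :=
    (continuous_lineSurvival_right (hq j) (w j) l).mul (by fun_prop)
  have hnn : ∀ s : ℝ, 0 ≤ lineSurvival (q j) (w j) l s * φ (l + s • w j) := fun s =>
    mul_nonneg (lineSurvival_pos _ _ _ _).le (hφ0 _)
  unfold duhamel
  rw [ENNReal.ofReal_add (mul_nonneg (lineSurvival_pos _ _ _ _).le (hρ0 _ _))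
    (intervalIntegral.integral_nonneg ht fun s _ => hnn s)]
  congr 1
  · exact (ENNReal.ofReal_mul (lineSurvival_pos _ _ _ _).le).symm
  · rw [intervalIntegral.integral_of_le ht, ← integral_Icc_eq_integral_Ioc,
      ofReal_integral_eq_lintegral_ofReal hcont.integrableOn_Icc
        (Filter.Eventually.of_forall hnn)]
    refine lintegral_congr fun s => ?_
    rw [ENNReal.ofReal_mul (lineSurvival_pos _ _ _ _).le, ← jump_extDensity hc0 hρ0]
    rfl

variable [MeasureSpace E] [BorelSpace E] [FiniteDimensional ℝ E]

/-- The exceptional null set depends on s; Tonelli on the set where F = G exchanges the two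
quantifiers. -/
theorem ae_setLIntegral_congr {E : Type*} [MeasureSpace E] [SFinite (volume : Measure E)]
    {F G : E × ℝ → ENNReal} (hF : Measurable F) (hG : Measurable G) {S : Set ℝ}
    (hS : MeasurableSet S) (h : ∀ s ∈ S, ∀ᵐ x, F (x, s) = G (x, s)) :
    ∀ᵐ x, ∫⁻ s in S, F (x, s) = ∫⁻ s in S, G (x, s) := by
  have h1 : ∀ᵐ s ∂(volume.restrict S), ∀ᵐ x, F (x, s) = G (x, s) :=
    ae_restrict_of_forall_mem hS h
  have h2 : ∀ᵐ x, ∀ᵐ s ∂(volume.restrict S), F (x, s) = G (x, s) :=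
    (Measure.ae_ae_comm (p := fun x s => F (x, s) = G (x, s)) (measurableSet_eq_fun hF hG)).2 h1
  filter_upwards [h2] with x hx using lintegral_congr_ae hx

/-- A continuous function is bounded above on a ball, uniformly in a finite index set. -/
theorem exists_bound_on_ball {ι E : Type*} [Fintype ι] [NormedAddCommGroup E] [NormedSpace ℝ E]
    [FiniteDimensional ℝ E] {f : ι → E → ℝ} (hf : ∀ j, Continuous (f j))
    (R : ℝ) :
    ∃ C, 0 ≤ C ∧ ∀ j l, ‖l‖ ≤ R → f j l ≤ C := by
  have : ProperSpace E := FiniteDimensional.proper ℝ E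
  have h : ∀ j, ∃ C, 0 ≤ C ∧ ∀ l, ‖l‖ ≤ R → f j l ≤ C := fun j => by
    obtain ⟨C, hC⟩ := (isCompact_closedBall (0 : E) R).exists_bound_of_continuousOn
      (hf j).continuousOn
    exact ⟨max C 0, le_max_right _ _, fun l hl => (le_abs_self _).trans
      ((hC l (by simpa using hl)).trans (le_max_left _ _))⟩
  choose C hC0 hC using h
  exact ⟨∑ j, C j, Finset.sum_nonneg fun j _ => hC0 j, fun j l hl => (hC j l hl).trans
    (Finset.single_le_sum (fun i _ => hC0 i) (Finset.mem_univ j))⟩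

/-- A solution of the stationarity equation is a fixed point of the Dyson series. -/
theorem tsum_dyson_eq_of_stationary (hq : ∀ j, Continuous (q j)) (hq0 : ∀ j l, 0 ≤ q j l)
    (hc0 : ∀ j i l, 0 ≤ c j i l) (hc : ∀ j i, Continuous (c j i)) (hρ0 : ∀ j l, 0 ≤ ρ j l)
    (hρ : ∀ j, Differentiable ℝ (ρ j))
    (hstat : ∀ j l, fderiv ℝ (ρ j) l (w j) - q j l * ρ j l + ∑ i, c j i l * ρ i l = 0)
    {t : ℝ} (ht : 0 ≤ t) (j : ι) (l : E) :
    ∑' n, dyson w q (extRate c) n t (extDensity ρ) j l = extDensity ρ j l := by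
  have hρc : ∀ j, Continuous (ρ j) := fun j => (hρ j).continuous
  have hrm : ∀ i j, Measurable (extRate c i j) := fun i j => (hc i j).measurable.ennreal_ofReal
  have hρm : ∀ i, Measurable (extDensity ρ i) := fun i => (hρc i).measurable.ennreal_ofReal
  refine tsum_dyson_eq_self hq hq0 hrm hρm ?_ ?_ ?_ ht j l
  · intro t ht j l
    rw [duhamel_eq_ofReal hq hc0 hc hρ0 hρc ht]
    have hd := hasDerivAt_duhamel (φ := fun x => ∑ i, c j i x * ρ i x) (hq j) (hρ j)
      (continuous_finsetSum _ fun i _ => (hc j i).mul (hρc i)) (w j) l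
    simp_rw [hstat, mul_zero] at hd
    -- By stationarity the Duhamel expression has zero derivative, so it keeps its value ρ at time
    -- 0.
    have h := is_const_of_deriv_eq_zero (fun t => (hd t).differentiableAt)
      (fun t => (hd t).deriv) t 0
    rw [h, duhamel_zero]
    rfl
  · intro R
    obtain ⟨C, hC0, hC⟩ := exists_bound_on_ball hρc R
    exact ⟨C, hC0, fun j l hl => ENNReal.ofReal_le_ofReal (hC j l hl)⟩
  · intro R
    obtain ⟨C, hC0, hC⟩ := exists_bound_on_ball
      (fun j => continuous_finsetSum Finset.univ fun i _ => hc j i) R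
    refine ⟨C, hC0, fun j l hl => ?_⟩
    unfold extRate
    rw [← ENNReal.ofReal_sum_of_nonneg fun i _ => hc0 j i l]
    exact ENNReal.ofReal_le_ofReal (hC j l hl)

/-- If the Dyson series reproduces a density almost everywhere at all times, then the density
solves the stationarity equation everywhere. -/
theorem stationary_of_tsum_dyson_ae_eq [(volume : Measure E).IsAddHaarMeasure]
    (hq : ∀ j, Continuous (q j))
    (hc0 : ∀ j i l, 0 ≤ c j i l) (hc : ∀ j i, Continuous (c j i)) (hρ0 : ∀ j l, 0 ≤ ρ j l)
    (hρ : ∀ j, Differentiable ℝ (ρ j))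
    (hfix : ∀ t, 0 ≤ t → ∀ j, (fun l => ∑' n, dyson w q (extRate c) n t (extDensity ρ) j l)
      =ᵐ[volume] extDensity ρ j) (j : ι) (l : E) :
    fderiv ℝ (ρ j) l (w j) - q j l * ρ j l + ∑ i, c j i l * ρ i l = 0 := by
  have : ProperSpace E := FiniteDimensional.proper ℝ E
  have hρc : ∀ j, Continuous (ρ j) := fun j => (hρ j).continuous
  set φ : E → ℝ := fun x => ∑ i, c j i x * ρ i x with hφ
  have hφc : Continuous φ := continuous_finsetSum _ fun i _ => (hc j i).mul (hρc i)
  have hφ0 : ∀ x, 0 ≤ φ x := fun x =>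
    Finset.sum_nonneg fun i _ => mul_nonneg (hc0 j i x) (hρ0 i x)
  have hrm : ∀ i j, Measurable (extRate c i j) := fun i j => (hc i j).measurable.ennreal_ofReal
  have hρm : ∀ i, Measurable (extDensity ρ i) := fun i => (hρc i).measurable.ennreal_ofReal
  have hconst : ∀ t, 0 ≤ t → duhamel (q j) (w j) (ρ j) φ l t = ρ j l := by
    intro t ht
    have hU : ∀ i, Measurable fun p : ℝ × E =>
        ∑' n, dyson w q (extRate c) n (t - p.1) (extDensity ρ) i p.2 := fun i =>
      Measurable.tsum fun n => measurable_dyson (α := ℝ × E) hq hrm n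
        (F := fun _ => extDensity ρ) (fun i => (hρm i).comp measurable_snd)
        (by fun_prop) (by fun_prop) i
    have hJ : ∀ i, Measurable fun p : ℝ × E => jump (extRate c) (fun k x =>
        ∑' n, dyson w q (extRate c) n (t - p.1) (extDensity ρ) k x) i p.2 := fun i =>
      measurable_jump (α := ℝ) hrm (F := fun s k x =>
        ∑' n, dyson w q (extRate c) n (t - s) (extDensity ρ) k x) hU i
    have hF : Measurable fun p : E × ℝ => flight w q p.2 (jump (extRate c) (fun k x =>
        ∑' n, dyson w q (extRate c) n (t - p.2) (extDensity ρ) k x)) j p.1 :=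
      measurable_flight (α := E × ℝ) hq (F := fun p => jump (extRate c) (fun k x =>
        ∑' n, dyson w q (extRate c) n (t - p.2) (extDensity ρ) k x))
        (fun i => (hJ i).comp
          (by fun_prop : Measurable fun p : (E × ℝ) × E => (p.1.2, p.2)))
        measurable_snd measurable_fst j
    have hJ' : ∀ i, Measurable (jump (extRate c) (extDensity ρ) i) := fun i =>
      (measurable_jump (α := ℝ) hrm (F := fun _ => extDensity ρ)
        (fun k => (hρm k).comp measurable_snd) i).comp
        (by fun_prop : Measurable fun x : E => ((0 : ℝ), x))
    have hF' : Measurable fun p : E × ℝ =>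
        flight w q p.2 (jump (extRate c) (extDensity ρ)) j p.1 :=
      measurable_flight (α := E × ℝ) hq (F := fun _ => jump (extRate c) (extDensity ρ))
        (fun i => (hJ' i).comp measurable_snd) measurable_snd measurable_fst j
    have hslice : ∀ s ∈ Set.Icc (0 : ℝ) t, ∀ᵐ x : E,
        flight w q s (jump (extRate c) (fun k x =>
          ∑' n, dyson w q (extRate c) n (t - s) (extDensity ρ) k x)) j x =
        flight w q s (jump (extRate c) (extDensity ρ)) j x := by
      intro s hs
      have h1 : ∀ᵐ x : E, ∀ i, ∑' n, dyson w q (extRate c) n (t - s) (extDensity ρ) i x =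
          extDensity ρ i x := ae_all_iff.2 fun i => hfix (t - s) (sub_nonneg.2 hs.2) i
      -- The flight evaluates the series at a translated point, and translations preserve null sets.
      have h2 := (measurePreserving_add_right (volume : Measure E)
        (s • w j)).quasiMeasurePreserving.ae h1
      filter_upwards [h2] with x hx
      unfold flight jump
      simp only [hx]
    have hswap := ae_setLIntegral_congr hF hF' measurableSet_Icc hslice
    have hae : (fun x => duhamel (q j) (w j) (ρ j) φ x t) =ᵐ[volume] ρ j := by
      filter_upwards [hswap, hfix t ht j] with x hx1 hx2
      rw [tsum_dyson hq hrm hρm, hx1,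
        duhamel_eq_ofReal hq hc0 hc hρ0 hρc ht] at hx2
      exact (ENNReal.ofReal_eq_ofReal_iff (duhamel_nonneg (hρ0 j) hφ0 _ _ ht) (hρ0 j x)).1 hx2
    exact congrFun ((Continuous.ae_eq_iff_eq volume
      (continuous_duhamel (hq j) (hρc j) hφc (w j) t) (hρc j)).1 hae) l
  have hd := hasDerivAt_duhamel (hq j) (hρ j) hφc (w j) l 0
  rw [lineSurvival_zero, zero_smul, add_zero, one_mul] at hd
  -- Constancy is known only for t ≥ 0, so derivatives are compared within the half-line.
  have h1 : HasDerivWithinAt (fun _ : ℝ => ρ j l) _ (Set.Ici 0) 0 :=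
    hd.hasDerivWithinAt.congr (fun t ht => (hconst t ht).symm) (hconst 0 le_rfl).symm
  exact (uniqueDiffOn_Ici (0 : ℝ) 0 Set.self_mem_Ici).eq_deriv _ h1
    (hasDerivWithinAt_const _ _ _)

end Stationary

/-! ### From the process to its density -/

section Invariance

variable {N d : ℕ}

/-- The rates `a` with the diagonal set to zero. -/
def offDiag {ι E : Type*} [DecidableEq ι] (a : ι → ι → E → ℝ) (j i : ι) (l : E) : ℝ :=
  if i ≠ j then a j i l else 0

/-- The transposed off-diagonal rates. -/
def offDiagTranspose {ι E : Type*} [DecidableEq ι] (a : ι → ι → E → ℝ) (j i : ι) (l : E) : ℝ :=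
  offDiag a i j l

theorem offDiag_nonneg {ι E : Type*} [DecidableEq ι] {a : ι → ι → E → ℝ}
    (ha : ∀ i j, i ≠ j → ∀ l, 0 ≤ a i j l) (j i : ι) (l : E) : 0 ≤ offDiag a j i l := by
  unfold offDiag
  split_ifs with h
  · exact ha j i (Ne.symm h) l
  · exact le_rfl

theorem continuous_offDiag {ι E : Type*} [DecidableEq ι] [TopologicalSpace E]
    {a : ι → ι → E → ℝ} (ha : ∀ i j, i ≠ j → Continuous (a i j)) (j i : ι) :
    Continuous (offDiag a j i) := by
  by_cases h : i ≠ j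
  · exact (ha j i h.symm).congr fun l => (if_pos h).symm
  · exact continuous_const.congr fun l => (if_neg h).symm

variable {v : Fin N → EuclideanSpace ℝ (Fin d)}
  {a : Fin N → Fin N → EuclideanSpace ℝ (Fin d) → ℝ}

theorem continuous_exitRate (ha : ∀ i j, i ≠ j → Continuous (a i j)) (j : Fin N) :
    Continuous (exitRate a j) :=
  continuous_finsetSum _ fun i hi => ha j i (Finset.mem_filter.1 hi).2.symm

theorem exitRate_nonneg (ha : ∀ i j, i ≠ j → ∀ l, 0 ≤ a i j l) (j : Fin N)
    (l : EuclideanSpace ℝ (Fin d)) : 0 ≤ exitRate a j l :=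
  Finset.sum_nonneg fun i hi => ha j i (Finset.mem_filter.1 hi).2.symm l

/-- The indicator function of a set of states. -/
def stateIndicator (B : Set (State N d)) (j : Fin N) (l : EuclideanSpace ℝ (Fin d)) : ENNReal :=
  B.indicator (fun _ => 1) (j, l)

theorem jump_offDiag (f : Fin N → EuclideanSpace ℝ (Fin d) → ENNReal) (j : Fin N)
    (l : EuclideanSpace ℝ (Fin d)) :
    jump (extRate (offDiag a)) f j l =
      ∑ i ∈ Finset.univ.filter (fun i => i ≠ j), ENNReal.ofReal (a j i l) * f i l := by
  rw [Finset.sum_filter]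
  refine Finset.sum_congr rfl fun i _ => ?_
  unfold extRate offDiag
  split_ifs <;> simp

/-- Both recursions condition on the first jump; zeroing the diagonal rates replaces the sum over i
≠ j by a full sum. -/
theorem jumpTransition_eq_dyson (n : ℕ) (t : ℝ) (j : Fin N) (l : EuclideanSpace ℝ (Fin d))
    (B : Set (State N d)) :
    jumpTransition v a n t j l B =
      dyson v (exitRate a) (extRate (offDiag a)) n t (stateIndicator B) j l := by
  induction n generalizing t j l with
  | zero => rfl
  | succ n ih =>
    rw [jumpTransition, dyson]
    refine lintegral_congr fun s => ?_
    unfold flight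
    rw [jump_offDiag]
    simp_rw [ih]
    rfl

theorem measurable_of_forall_fin {F : State N d → ENNReal}
    (hF : ∀ j, Measurable fun l => F (j, l)) : Measurable F :=
  measurable_from_prod_countable_right hF

theorem lintegral_productMeasure {p : Fin N → ℝ} (hp : ∀ j, 0 ≤ p j)
    {g : EuclideanSpace ℝ (Fin d) → ℝ} (hg : Measurable g) {F : State N d → ENNReal}
    (hF : ∀ j, Measurable fun l => F (j, l)) :
    ∫⁻ x, F x ∂(productMeasure p g) =
      pairing (extDensity fun j l => p j * g l) fun j l => F (j, l) := by
  unfold productMeasure pairing extDensity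
  rw [lintegral_prod _ (measurable_of_forall_fin hF).aemeasurable,
    lintegral_finsetSum_measure]
  refine Finset.sum_congr rfl fun j _ => ?_
  rw [lintegral_smul_measure, lintegral_dirac,
    lintegral_withDensity_eq_lintegral_mul _ hg.ennreal_ofReal (hF j), smul_eq_mul,
    ← lintegral_const_mul _ (hg.ennreal_ofReal.mul (hF j))]
  refine lintegral_congr fun l => ?_
  rw [ENNReal.ofReal_mul (hp j), mul_assoc]
  rfl

theorem measurable_stateIndicator {B : Set (State N d)} (hB : MeasurableSet B) (j : Fin N) :
    Measurable (stateIndicator B j) :=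
  (measurable_const.indicator hB).comp measurable_prodMk_left

/-- The density at time `t` of the process started with density `ρ`. -/
def evolvedDensity (v : Fin N → EuclideanSpace ℝ (Fin d))
    (a : Fin N → Fin N → EuclideanSpace ℝ (Fin d) → ℝ) (t : ℝ)
    (ρ : Fin N → EuclideanSpace ℝ (Fin d) → ENNReal) (j : Fin N)
    (l : EuclideanSpace ℝ (Fin d)) : ENNReal :=
  ∑' n, dyson (fun j => -v j) (exitRate a) (extRate (offDiagTranspose a)) n t ρ j l

theorem measurable_dyson_const {ι : Type*} [Fintype ι] {E : Type} [NormedAddCommGroup E]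
    [NormedSpace ℝ E] [MeasurableSpace E] [BorelSpace E] [FiniteDimensional ℝ E]
    {w : ι → E} {q : ι → E → ℝ} {r : ι → ι → E → ENNReal}
    (hq : ∀ j, Continuous (q j)) (hr : ∀ i j, Measurable (r i j)) (n : ℕ) (t : ℝ)
    {f : ι → E → ENNReal} (hf : ∀ j, Measurable (f j)) (j : ι) :
    Measurable (dyson w q r n t f j) :=
  measurable_dyson (α := E) hq hr n (F := fun _ => f) (fun i => (hf i).comp measurable_snd)
    measurable_const measurable_id j

theorem pairing_tsum_right {ι E : Type*} [Fintype ι] [MeasureSpace E] {h : ι → E → ENNReal}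
    (hh : ∀ j, Measurable (h j)) {f : ℕ → ι → E → ENNReal} (hf : ∀ n j, Measurable (f n j)) :
    pairing h (fun j l => ∑' n, f n j l) = ∑' n, pairing h (f n) := by
  unfold pairing
  rw [Summable.tsum_finsetSum fun _ _ => ENNReal.summable]
  refine Finset.sum_congr rfl fun j _ => ?_
  have hm : ∀ n, Measurable fun l => h j l * f n j l := fun n => (hh j).mul (hf n j)
  rw [← lintegral_tsum fun n => (hm n).aemeasurable]
  simp only [ENNReal.tsum_mul_left]

theorem measurable_evolvedDensity (ha : ∀ i j, i ≠ j → Continuous (a i j)) (t : ℝ)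
    {ρ : Fin N → EuclideanSpace ℝ (Fin d) → ENNReal} (hρ : ∀ j, Measurable (ρ j)) (j : Fin N) :
    Measurable (evolvedDensity v a t ρ j) :=
  Measurable.tsum fun n => measurable_dyson_const (continuous_exitRate ha)
    (fun i k => (continuous_offDiag ha k i).measurable.ennreal_ofReal) n t hρ j

/-- Duality term by term, summed over the number of jumps: the evolution moves from the indicator of
B to the density. -/
theorem lintegral_transition (ha : ∀ i j, i ≠ j → Continuous (a i j)) {p : Fin N → ℝ}
    (hp : ∀ j, 0 ≤ p j) {g : EuclideanSpace ℝ (Fin d) → ℝ} (hg : Measurable g) (t : ℝ)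
    {B : Set (State N d)} (hB : MeasurableSet B) :
    ∫⁻ x, transition v a t x B ∂(productMeasure p g) =
      pairing (evolvedDensity v a t (extDensity fun j l => p j * g l)) (stateIndicator B) := by
  have hq := continuous_exitRate ha
  have hr : ∀ i j, Measurable (extRate (offDiag a) i j) := fun i j =>
    (continuous_offDiag ha i j).measurable.ennreal_ofReal
  have hr' : ∀ i j, Measurable (extRate (offDiagTranspose a) i j) := fun i j => hr j i
  have hI := measurable_stateIndicator hB
  have hρ : ∀ j, Measurable (extDensity (fun j l => p j * g l) j) := fun j =>
    (hg.const_mul (p j)).ennreal_ofReal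
  have hT : ∀ n j, Measurable
      (dyson v (exitRate a) (extRate (offDiag a)) n t (stateIndicator B) j) := fun n =>
    measurable_dyson_const hq hr n t hI
  have hT' : ∀ n j, Measurable (dyson (fun j => -v j) (exitRate a) (extRate (offDiagTranspose a))
      n t (extDensity fun j l => p j * g l) j) := fun n =>
    measurable_dyson_const hq hr' n t hρ
  unfold transition
  simp_rw [jumpTransition_eq_dyson]
  rw [lintegral_productMeasure hp hg (F := fun x => ∑' n, dyson v (exitRate a)
    (extRate (offDiag a)) n t (stateIndicator B) x.1 x.2)
    (fun j => Measurable.tsum fun n => hT n j), pairing_tsum_right hρ hT]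
  unfold evolvedDensity
  rw [pairing_comm, pairing_tsum_right hI hT']
  refine tsum_congr fun n => ?_
  rw [pairing_dyson hq hr n t hρ hI, pairing_comm]
  rfl

theorem productMeasure_apply {p : Fin N → ℝ} (hp : ∀ j, 0 ≤ p j)
    {g : EuclideanSpace ℝ (Fin d) → ℝ} (hg : Measurable g)
    {B : Set (State N d)} (hB : MeasurableSet B) :
    productMeasure p g B = pairing (extDensity fun j l => p j * g l) (stateIndicator B) := by
  rw [← lintegral_indicator_one hB]
  exact lintegral_productMeasure hp hg (F := B.indicator fun _ => 1)
    (measurable_stateIndicator hB)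

theorem pairing_stateIndicator_slice (h : Fin N → EuclideanSpace ℝ (Fin d) → ENNReal)
    (j : Fin N) {S : Set (EuclideanSpace ℝ (Fin d))} (hS : MeasurableSet S) :
    pairing h (stateIndicator ({j} ×ˢ S)) = ∫⁻ l in S, h j l := by
  unfold pairing
  rw [Finset.sum_eq_single j]
  · rw [← lintegral_indicator hS]
    refine lintegral_congr fun l => ?_
    by_cases hl : l ∈ S <;> simp [stateIndicator, hl]
  · intro i _ hij
    simp [stateIndicator, hij]
  · simp

/-- Testing on the sets {j} × S determines each component of the density almost everywhere, with a
null set that may depend on t. -/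
theorem isInvariant_iff (ha : ∀ i j, i ≠ j → Continuous (a i j)) {p : Fin N → ℝ}
    (hp : ∀ j, 0 ≤ p j) {g : EuclideanSpace ℝ (Fin d) → ℝ} (hg : Measurable g) :
    IsInvariant v a (productMeasure p g) ↔
      ∀ t, 0 ≤ t → ∀ j, evolvedDensity v a t (extDensity fun j l => p j * g l) j
        =ᵐ[volume] extDensity (fun j l => p j * g l) j := by
  have hρ : ∀ j, Measurable (extDensity (fun j l => p j * g l) j) := fun j =>
    (hg.const_mul (p j)).ennreal_ofReal
  constructor
  · intro h t ht j
    refine ae_eq_of_forall_setLIntegral_eq_of_sigmaFinite (measurable_evolvedDensity ha t hρ j)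
      (hρ j) fun S hS _ => ?_
    have hB : MeasurableSet (({j} : Set (Fin N)) ×ˢ S) := (measurableSet_singleton j).prod hS
    have h1 := h t ht _ hB
    rwa [lintegral_transition ha hp hg t hB, productMeasure_apply hp hg hB,
      pairing_stateIndicator_slice _ _ hS, pairing_stateIndicator_slice _ _ hS] at h1
  · intro h t ht B hB
    rw [lintegral_transition ha hp hg t hB, productMeasure_apply hp hg hB]
    refine Finset.sum_congr rfl fun j _ => lintegral_congr_ae ?_
    filter_upwards [h t ht j] with l hl
    rw [hl]

theorem fderiv_apply_eq_inner_gradient (f : EuclideanSpace ℝ (Fin d) → ℝ)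
    (x l : EuclideanSpace ℝ (Fin d)) : fderiv ℝ f l x = inner ℝ x (gradient f l) := by
  rw [real_inner_comm, gradient, InnerProductSpace.toDual_symm_apply]

/-- The form needed for the abstract results: velocities -v, killing at the exit rate, transposed
jump rates. -/
theorem adjointGenerator_eq (ρ : Fin N → EuclideanSpace ℝ (Fin d) → ℝ) (j : Fin N)
    (l : EuclideanSpace ℝ (Fin d)) :
    adjointGenerator v a ρ j l = fderiv ℝ (ρ j) l (-v j) - exitRate a j l * ρ j l +
      ∑ i, offDiagTranspose a j i l * ρ i l := by
  have h : ∑ i, offDiagTranspose a j i l * ρ i l =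
      ∑ i ∈ Finset.univ.filter (fun i => i ≠ j), a i j l * ρ i l := by
    rw [Finset.sum_filter]
    refine Finset.sum_congr rfl fun i _ => ?_
    by_cases hij : i = j <;> simp [offDiagTranspose, offDiag, hij, Ne.symm]
  rw [h, map_neg, fderiv_apply_eq_inner_gradient, adjointGenerator, exitRate,
    Finset.sum_sub_distrib, Finset.sum_mul]
  ring

/-- A product measure with differentiable density is invariant if and only if its density solves
the stationarity equation. -/
theorem isInvariant_iff_stationaryEquation (ha0 : ∀ i j, i ≠ j → ∀ l, 0 ≤ a i j l)
    (ha : ∀ i j, i ≠ j → Continuous (a i j)) {p : Fin N → ℝ}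
    (hp : ∀ j, 0 ≤ p j) {g : EuclideanSpace ℝ (Fin d) → ℝ} (hg : Differentiable ℝ g)
    (hg0 : ∀ l, 0 ≤ g l) :
    IsInvariant v a (productMeasure p g) ↔ StationaryEquation v a p g := by
  have hρ0 : ∀ (j : Fin N) l, 0 ≤ p j * g l := fun j l => mul_nonneg (hp j) (hg0 l)
  have hρ : ∀ j : Fin N, Differentiable ℝ fun l => p j * g l := fun j => hg.const_mul (p j)
  have hc0 : ∀ j i l, 0 ≤ offDiagTranspose a j i l := fun j i l => offDiag_nonneg ha0 i j l
  have hc : ∀ j i, Continuous (offDiagTranspose a j i) := fun j i => continuous_offDiag ha i j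
  rw [isInvariant_iff ha hp hg.continuous.measurable]
  unfold StationaryEquation
  simp_rw [adjointGenerator_eq]
  constructor
  · exact fun h => stationary_of_tsum_dyson_ae_eq (w := fun j => -v j)
      (ρ := fun j l => p j * g l) (continuous_exitRate ha) hc0 hc hρ0 hρ h
  · exact fun h t ht j => Filter.Eventually.of_forall fun l =>
      tsum_dyson_eq_of_stationary (w := fun j => -v j) (ρ := fun j l => p j * g l)
        (continuous_exitRate ha) (exitRate_nonneg ha0) hc0 hc hρ0 hρ h ht j l

end Invariance

/-! ### The Gaussian density and uniqueness -/

section Gaussian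

variable {N d : ℕ}

theorem gaussianDensity_pos (l : EuclideanSpace ℝ (Fin d)) : 0 < gaussianDensity d l := by
  unfold gaussianDensity
  positivity

theorem hasGradientAt_gaussianDensity (l : EuclideanSpace ℝ (Fin d)) :
    HasGradientAt (gaussianDensity d) (-(gaussianDensity d l • l)) l := by
  rw [hasGradientAt_iff_hasFDerivAt]
  have h := ((((hasStrictFDerivAt_norm_sq l).hasFDerivAt.neg.mul_const (2⁻¹ : ℝ)).exp).const_mul
    ((2 * Real.pi) ^ (-(d : ℝ) / 2)))
  refine (h.congr_fderiv ?_)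
  ext x
  simp [gaussianDensity, div_eq_mul_inv]
  ring

theorem differentiable_gaussianDensity : Differentiable ℝ (gaussianDensity d) := fun l =>
  (hasGradientAt_gaussianDensity l).differentiableAt

theorem integral_gaussianDensity : ∫ l, gaussianDensity d l = 1 := by
  have h := GaussianFourier.integral_rexp_neg_mul_sq_norm (V := EuclideanSpace ℝ (Fin d))
    (b := 2⁻¹) (by norm_num)
  unfold gaussianDensity
  rw [integral_const_mul]
  have h2 : ∀ l : EuclideanSpace ℝ (Fin d), -‖l‖ ^ 2 / 2 = -(2⁻¹ : ℝ) * ‖l‖ ^ 2 := fun l => by ring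
  simp_rw [h2]
  rw [h, finrank_euclideanSpace_fin, div_inv_eq_mul, mul_comm Real.pi, ← Real.rpow_add (by positivity)]
  rw [neg_div, neg_add_cancel, Real.rpow_zero]

theorem gradient_const_mul (c : ℝ) (g : EuclideanSpace ℝ (Fin d) → ℝ)
    {l : EuclideanSpace ℝ (Fin d)} (hg : DifferentiableAt ℝ g l) :
    gradient (fun x => c * g x) l = c • gradient g l := by
  unfold gradient
  rw [fderiv_const_mul hg, map_smul]

theorem adjointGenerator_product {v : Fin N → EuclideanSpace ℝ (Fin d)}
    {a : Fin N → Fin N → EuclideanSpace ℝ (Fin d) → ℝ} (p : Fin N → ℝ)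
    {g : EuclideanSpace ℝ (Fin d) → ℝ} (hg : Differentiable ℝ g) (j : Fin N)
    (l : EuclideanSpace ℝ (Fin d)) :
    adjointGenerator v a (fun i x => p i * g x) j l = -(p j * inner ℝ (v j) (gradient g l)) +
      g l * ∑ i ∈ Finset.univ.filter (fun i => i ≠ j), (p i * a i j l - p j * a j i l) := by
  rw [adjointGenerator, gradient_const_mul _ _ (hg l), real_inner_smul_right, Finset.mul_sum]
  congr 1
  exact Finset.sum_congr rfl fun i _ => by ring

theorem stationaryEquation_gaussianDensity_iff {v : Fin N → EuclideanSpace ℝ (Fin d)}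
    {a : Fin N → Fin N → EuclideanSpace ℝ (Fin d) → ℝ} (p : Fin N → ℝ) :
    StationaryEquation v a p (gaussianDensity d) ↔
      ∀ (j : Fin N) (l : EuclideanSpace ℝ (Fin d)), p j * inner ℝ (v j) l +
        ∑ i ∈ Finset.univ.filter (fun i => i ≠ j), (p i * a i j l - p j * a j i l) = 0 := by
  refine forall₂_congr fun j l => ?_
  rw [adjointGenerator_product p differentiable_gaussianDensity,
    (hasGradientAt_gaussianDensity l).gradient, inner_neg_right, real_inner_smul_right]
  have h : ∀ S : ℝ, -(p j * -(gaussianDensity d l * inner ℝ (v j) l)) + gaussianDensity d l * S =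
      gaussianDensity d l * (p j * inner ℝ (v j) l + S) := fun S => by ring
  rw [h, mul_eq_zero, or_iff_right (gaussianDensity_pos l).ne']

/-- Substituting the balance condition into stationarity leaves p_j v_j · (∇g + g l) = 0, so ∇g + g
l is orthogonal to the span of the v_j, which is everything. -/
theorem gradient_eq_of_stationaryEquation {v : Fin N → EuclideanSpace ℝ (Fin d)}
    (hv : Module.finrank ℝ (Submodule.span ℝ (Set.range v)) = d)
    {a : Fin N → Fin N → EuclideanSpace ℝ (Fin d) → ℝ} {p : Fin N → ℝ} (hp : ∀ j, 0 < p j)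
    (hbal : ∀ (j : Fin N) (l : EuclideanSpace ℝ (Fin d)), p j * inner ℝ (v j) l +
        ∑ i ∈ Finset.univ.filter (fun i => i ≠ j), (p i * a i j l - p j * a j i l) = 0)
    {g : EuclideanSpace ℝ (Fin d) → ℝ} (hg : Differentiable ℝ g)
    (hstat : StationaryEquation v a p g) (l : EuclideanSpace ℝ (Fin d)) :
    gradient g l = -(g l • l) := by
  have htop : Submodule.span ℝ (Set.range v) = ⊤ :=
    Submodule.eq_top_of_finrank_eq (by rw [hv, finrank_euclideanSpace_fin])
  have h0 : ∀ j, inner ℝ (v j) (gradient g l + g l • l) = 0 := by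
    intro j
    have h1 := hstat j l
    rw [adjointGenerator_product p hg, eq_neg_of_add_eq_zero_right (hbal j l)] at h1
    rw [inner_add_right, real_inner_smul_right]
    refine (mul_eq_zero.1 (?_ : p j * _ = 0)).resolve_left (hp j).ne'
    linarith
  have hmem : gradient g l + g l • l ∈ (Submodule.span ℝ (Set.range v))ᗮ := by
    rw [Submodule.mem_orthogonal]
    intro u hu
    induction hu using Submodule.span_induction with
    | mem x hx =>
      obtain ⟨j, rfl⟩ := hx
      exact h0 j
    | zero => exact inner_zero_left _
    | add x y _ _ hx hy => rw [inner_add_left, hx, hy, add_zero]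
    | smul c x _ hx => rw [real_inner_smul_left, hx, mul_zero]
  rw [htop, Submodule.top_orthogonal_eq_bot, Submodule.mem_bot] at hmem
  exact eq_neg_of_add_eq_zero_left hmem

/-- With the integrating factor e^{|l|²/2} the derivative vanishes, so g is a multiple of γ; equal
integrals make the factor 1. -/
theorem eq_gaussianDensity_of_gradient {g : EuclideanSpace ℝ (Fin d) → ℝ}
    (hg : Differentiable ℝ g) (hgrad : ∀ l, gradient g l = -(g l • l)) (hint : ∫ l, g l = 1) :
    g = gaussianDensity d := by
  have hd : ∀ l, HasFDerivAt (fun x => g x * Real.exp (‖x‖ ^ 2 * 2⁻¹))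
      (0 : EuclideanSpace ℝ (Fin d) →L[ℝ] ℝ) l := by
    intro l
    have h := ((hasStrictFDerivAt_norm_sq l).hasFDerivAt.mul_const (2⁻¹ : ℝ)).exp
    refine ((hg l).hasFDerivAt.mul h).congr_fderiv ?_
    ext x
    simp [fderiv_apply_eq_inner_gradient, hgrad, real_inner_smul_right, real_inner_comm l x]
    ring
  have hconst := is_const_of_fderiv_eq_zero (fun l => (hd l).differentiableAt)
    fun l => (hd l).fderiv
  have hmul : ∀ l, g l = g 0 / gaussianDensity d 0 * gaussianDensity d l := fun l => by
    have h := hconst l 0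
    have hexp : Real.exp (-‖l‖ ^ 2 / 2) = (Real.exp (‖l‖ ^ 2 * 2⁻¹))⁻¹ := by
      rw [← Real.exp_neg]
      congr 1
      ring
    have hpos : (2 * Real.pi) ^ (-(d : ℝ) / 2) ≠ 0 := by positivity
    simp only [norm_zero, ne_eq, OfNat.ofNat_ne_zero, not_false_eq_true, zero_pow, zero_mul,
      Real.exp_zero, mul_one] at h
    simp only [gaussianDensity, hexp, ← h, norm_zero, ne_eq, OfNat.ofNat_ne_zero,
      not_false_eq_true, zero_pow, neg_zero, zero_div, Real.exp_zero, mul_one]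
    field_simp
  have hc : g 0 / gaussianDensity d 0 = 1 := by
    rw [integral_congr_ae (Filter.Eventually.of_forall hmul), integral_const_mul,
      integral_gaussianDensity, mul_one] at hint
    exact hint
  funext l
  rw [hmul l, hc, one_mul]

end Gaussian

end

end InertDrift

theorem mainTheorem3 {N d : ℕ} (hN : 1 < N) (hd : 1 ≤ d)
    (v : Fin N → EuclideanSpace ℝ (Fin d))
    (hv : Module.finrank ℝ (Submodule.span ℝ (Set.range v)) = d)
    (a : Fin N → Fin N → EuclideanSpace ℝ (Fin d) → ℝ)
    (ha_nonneg : ∀ i j, i ≠ j → ∀ l, 0 ≤ a i j l)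
    (ha_cont : ∀ i j, i ≠ j → Continuous (a i j))
    (p : Fin N → ℝ) (hp_pos : ∀ j, 0 < p j) (hp_sum : ∑ j, p j = 1) :
    -- the Gaussian product measure is invariant iff the balance condition holds
    (InertDrift.IsInvariant v a
        (InertDrift.productMeasure p (InertDrift.gaussianDensity d)) ↔
      ∀ (j : Fin N) (l : EuclideanSpace ℝ (Fin d)),
        p j * inner ℝ (v j) l +
          ∑ i ∈ Finset.univ.filter (fun i => i ≠ j), (p i * a i j l - p j * a j i l) = 0) ∧
    -- the same with the balance condition written through b
    (InertDrift.IsInvariant v a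
        (InertDrift.productMeasure p (InertDrift.gaussianDensity d)) ↔
      ∀ (j : Fin N) (l : EuclideanSpace ℝ (Fin d)),
        p j * inner ℝ (v j) l +
          ∑ i ∈ Finset.univ.filter (fun i => i ≠ j), InertDrift.netFlow p a i j l = 0) ∧
    -- under the balance condition, no other density is possible
    ((∀ (j : Fin N) (l : EuclideanSpace ℝ (Fin d)),
        p j * inner ℝ (v j) l +
          ∑ i ∈ Finset.univ.filter (fun i => i ≠ j), InertDrift.netFlow p a i j l = 0) →
      ∀ g : EuclideanSpace ℝ (Fin d) → ℝ, Differentiable ℝ g → (∀ l, 0 ≤ g l) →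
        MeasureTheory.Integrable g → ∫ l, g l = 1 →
        (InertDrift.StationaryEquation v a p g →
          (∀ l, gradient g l = -(g l • l)) ∧ g = InertDrift.gaussianDensity d) ∧
        (InertDrift.IsInvariant v a (InertDrift.productMeasure p g) →
          g = InertDrift.gaussianDensity d)) := by

  have hinv : ∀ g : EuclideanSpace ℝ (Fin d) → ℝ, Differentiable ℝ g → (∀ l, 0 ≤ g l) →
      (InertDrift.IsInvariant v a (InertDrift.productMeasure p g) ↔
        InertDrift.StationaryEquation v a p g) := fun g hg hg0 =>
    InertDrift.isInvariant_iff_stationaryEquation ha_nonneg ha_cont (fun j => (hp_pos j).le) hg hg0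
  have hgauss := (hinv _ InertDrift.differentiable_gaussianDensity
    fun l => (InertDrift.gaussianDensity_pos l).le).trans
    (InertDrift.stationaryEquation_gaussianDensity_iff p)
  -- One proof serves both forms of the balance condition, which agree on unfolding `netFlow`.
  refine ⟨hgauss, hgauss, fun hbal g hg hg0 _ hint => ?_⟩
  have hstat : InertDrift.StationaryEquation v a p g →
      (∀ l, gradient g l = -(g l • l)) ∧ g = InertDrift.gaussianDensity d := fun h => by
    have hgrad := InertDrift.gradient_eq_of_stationaryEquation hv hp_pos hbal hg h
    exact ⟨hgrad, InertDrift.eq_gaussianDensity_of_gradient hg hgrad hint⟩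
  exact ⟨hstat, fun h => (hstat ((hinv g hg hg0).1 h)).2⟩
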